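/- Let $\mathbb{R}[x,y]$ and $\mathbb{R}[x,y,z]$ be the polynomial rings over the field of real numbers in two and three variables. The quotient rings $$\mathbb{R}[x,y]/(x^2+y^2+1)\qquad\text{and}\qquad \mathbb{R}[x,y,z]/(x^2+y^2+z^2)$$ are unique factorization domains. -/

import Mathlib

open MvPolynomial

/-! For the conic, every maximal ideal is the kernel of a complex point, which is nonreal since the
conic has no real points. The real line through the point and its conjugate meets the conic only in
that pair, so its equation generates the ideal (`ker_eq_span_of_im_ne_zero`). A Noetherian domain
with principal maximal ideals is factorial. The cone becomes the polynomial ring over the conic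
after inverting `z`. Since `z` is prime (`PointlessCone.prime_coord_two`), factoriality descends by
Nagata's criterion. -/

/-! ### Nagata's criterion -/

theorem WfDvdMonoid.exists_eq_pow_mul_of_prime {B : Type*} [CommRing B] [IsDomain B]
    [WfDvdMonoid B] {z : B} (hz : Prime z) {b : B} (hb : b ≠ 0) :
    ∃ (n : ℕ) (c : B), ¬ z ∣ c ∧ b = z ^ n * c :=
  WfDvdMonoid.max_power_factor hb hz.irreducible

/-- A form of Nagata's criterion: `B` and `U` become isomorphic after inverting the prime `z`. -/
theorem UniqueFactorizationMonoid.of_prime_of_injective {B U : Type*} [CommRing B] [IsDomain B]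
    [WfDvdMonoid B] [CommRing U] [IsDomain U] [UniqueFactorizationMonoid U]
    (ψ : B →+* U) (hψ : Function.Injective ψ) {z : B} (hz : Prime z) (hψz : Prime (ψ z))
    (hsurj : ∀ u : U, ∃ (n : ℕ) (b : B), ψ b = ψ z ^ n * u) :
    UniqueFactorizationMonoid B := by
  have key : ∀ b : B, ¬ z ∣ b → Irreducible b → Prime b := by
    intro b hzb hb
    have hψb : ψ b ≠ 0 := (map_ne_zero_iff ψ hψ).2 hb.ne_zero
    obtain ⟨k, v, hv, hbv⟩ := WfDvdMonoid.exists_eq_pow_mul_of_prime hψz hψb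
    have hv0 : v ≠ 0 := by rintro rfl; exact hv (dvd_zero _)
    -- The cofactor lifts to `B` up to a power of `z`, and that power cancels because `z ∤ b`.
    have descend : ∀ c : B, v ∣ ψ c → b ∣ c := by
      rintro c ⟨u, hu⟩
      obtain ⟨n, e, he⟩ := hsurj u
      have h1 : b * e = z ^ (n + k) * c := by
        apply hψ
        simp only [map_mul, map_pow, hu, he]
        rw [hbv]; ring
      obtain ⟨e', rfl⟩ := hz.pow_dvd_of_dvd_mul_left (n + k) hzb ⟨c, h1⟩
      refine ⟨e', mul_left_cancel₀ (pow_ne_zero (n + k) hz.ne_zero) ?_⟩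
      rw [← h1]; ring
    have hvu : ¬ IsUnit v := fun h =>
      hb.not_isUnit (isUnit_of_dvd_one (descend 1 (h.dvd)))
    have isUnit_factor : ∀ (v₁ : U) (i n : ℕ) (c : B), ¬ ψ z ∣ v₁ → IsUnit c →
        ψ (z ^ i * c) = ψ z ^ n * v₁ → IsUnit v₁ := by
      intro v₁ i n c h1 hc h
      have h2 : v₁ ∣ ψ z ^ i * ψ c := ⟨ψ z ^ n, by rw [← map_pow, ← map_mul, h, mul_comm]⟩
      have h3 : v₁ ∣ ψ z ^ i := ((hc.map ψ).dvd_mul_right).1 h2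
      obtain ⟨j, -, hj⟩ := (dvd_prime_pow hψz i).1 h3
      rcases j with _ | j
      · simpa using hj.isUnit_iff.2
      · exact absurd ((dvd_pow_self _ j.succ_ne_zero).trans hj.symm.dvd) h1
    -- The factors of `v` lift, up to powers of `z`, to `c₁` and `c₂` with `c₁ * c₂` associated to
    -- `b`.
    have hvirr : Irreducible v := by
      refine ⟨hvu, fun {v₁ v₂} h12 => ?_⟩
      have hz1 : ¬ ψ z ∣ v₁ := fun h => hv (h12 ▸ h.mul_right _)
      have hz2 : ¬ ψ z ∣ v₂ := fun h => hv (h12 ▸ h.mul_left _)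
      obtain ⟨n₁, e₁, he₁⟩ := hsurj v₁
      obtain ⟨n₂, e₂, he₂⟩ := hsurj v₂
      have hv12 : v₁ * v₂ ≠ 0 := h12 ▸ hv0
      have he₁0 : e₁ ≠ 0 := by
        rintro rfl
        rw [map_zero] at he₁
        exact mul_ne_zero (pow_ne_zero _ hψz.ne_zero) (left_ne_zero_of_mul hv12) he₁.symm
      have he₂0 : e₂ ≠ 0 := by
        rintro rfl
        rw [map_zero] at he₂
        exact mul_ne_zero (pow_ne_zero _ hψz.ne_zero) (right_ne_zero_of_mul hv12) he₂.symm
      obtain ⟨i, c₁, hc₁, rfl⟩ := WfDvdMonoid.exists_eq_pow_mul_of_prime hz he₁0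
      obtain ⟨j, c₂, hc₂, rfl⟩ := WfDvdMonoid.exists_eq_pow_mul_of_prime hz he₂0
      have hprod : z ^ (n₁ + n₂) * b = z ^ (i + j + k) * (c₁ * c₂) := by
        apply hψ
        have h : ψ (z ^ i * c₁) * ψ (z ^ j * c₂) * ψ z ^ k =
            ψ z ^ (n₁ + n₂) * ψ b := by
          rw [he₁, he₂, hbv, h12]; ring
        simp only [map_mul, map_pow] at h ⊢
        rw [← h]; ring
      have hdvd : b ∣ c₁ * c₂ := by
        obtain ⟨f, hf⟩ := hz.pow_dvd_of_dvd_mul_left (i + j + k) hzb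
          (a := b) (b := z ^ (n₁ + n₂)) ⟨c₁ * c₂, by rw [← hprod, mul_comm]⟩
        refine ⟨f, mul_left_cancel₀ (pow_ne_zero (i + j + k) hz.ne_zero) ?_⟩
        rw [← hprod, hf]; ring
      have hzc : ¬ z ∣ c₁ * c₂ := fun h => (hz.dvd_or_dvd h).elim hc₁ hc₂
      have hdvd' : c₁ * c₂ ∣ b := by
        obtain ⟨f, hf⟩ := hz.pow_dvd_of_dvd_mul_left (n₁ + n₂) hzc
          (b := z ^ (i + j + k)) ⟨b, by rw [hprod, mul_comm]⟩
        refine ⟨f, mul_left_cancel₀ (pow_ne_zero (n₁ + n₂) hz.ne_zero) ?_⟩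
        rw [hprod, hf]; ring
      have hirr : Irreducible (c₁ * c₂) :=
        (associated_of_dvd_dvd hdvd hdvd').irreducible hb
      exact (hirr.isUnit_or_isUnit rfl).imp
        (fun h => isUnit_factor v₁ i n₁ c₁ hz1 h he₁)
        (fun h => isUnit_factor v₂ j n₂ c₂ hz2 h he₂)
    have hvprime : Prime v := hvirr.prime
    refine ⟨hb.ne_zero, hb.not_isUnit, fun c d hcd => ?_⟩
    have : v ∣ ψ c * ψ d := by
      rw [← map_mul]
      exact (Dvd.intro_left _ hbv.symm).trans (map_dvd ψ hcd)
    exact (hvprime.dvd_or_dvd this).imp (descend c) (descend d)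
  refine { irreducible_iff_prime := fun {b} => ⟨fun hb => ?_, Prime.irreducible⟩ }
  by_cases hzb : z ∣ b
  · exact ((hz.irreducible.associated_of_dvd hb hzb).prime_iff).1 hz
  · exact key b hzb hb

/-! ### Primality of the quadratic forms -/

/-- A monic quadratic over a domain is reducible only if it has a root `p`; evaluating `p ^ 2 + g =
0` at `a` contradicts positivity. -/
theorem MvPolynomial.prime_X_zero_sq_add_rename_succ {n : ℕ} (g : MvPolynomial (Fin n) ℝ)
    (a : Fin n → ℝ) (ha : 0 < eval a g) :
    Prime (X 0 ^ 2 + rename Fin.succ g : MvPolynomial (Fin (n + 1)) ℝ) := by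
  rw [← MulEquiv.prime_iff (finSuccEquiv ℝ n)]
  have h : finSuccEquiv ℝ n (X 0 ^ 2 + rename Fin.succ g) =
      Polynomial.X ^ 2 + Polynomial.C g := by
    have hg : (finSuccEquiv ℝ n).toAlgHom.comp (rename Fin.succ) =
        (IsScalarTower.toAlgHom ℝ (MvPolynomial (Fin n) ℝ) (Polynomial (MvPolynomial (Fin n) ℝ))) :=
      algHom_ext fun i => by simp [finSuccEquiv_X_succ]
    rw [map_add, map_pow, finSuccEquiv_X_zero]
    exact congrArg _ (DFunLike.congr_fun hg g)
  rw [h]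
  apply Irreducible.prime
  rw [(Polynomial.monic_X_pow_add_C g two_ne_zero).irreducible_iff_roots_eq_zero_of_degree_le_three
    (by rw [Polynomial.natDegree_X_pow_add_C]) (by rw [Polynomial.natDegree_X_pow_add_C]; norm_num)]
  refine Multiset.eq_zero_of_forall_notMem fun p hp => ?_
  have h0 := (Polynomial.mem_roots'.1 hp).2
  simp only [Polynomial.IsRoot, Polynomial.eval_add, Polynomial.eval_pow, Polynomial.eval_X,
    Polynomial.eval_C] at h0
  have h1 := congrArg (eval a) h0
  simp only [map_add, map_pow, map_zero] at h1
  nlinarith [sq_nonneg (eval a p)]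

theorem MvPolynomial.prime_sq_add_sq :
    Prime (X 0 ^ 2 + X 1 ^ 2 : MvPolynomial (Fin 2) ℝ) := by
  have h := prime_X_zero_sq_add_rename_succ (n := 1) (X 0 ^ 2) 1 (by simp)
  rwa [map_pow, rename_X] at h

theorem MvPolynomial.prime_sq_add_sq_add_one :
    Prime (X 0 ^ 2 + X 1 ^ 2 + 1 : MvPolynomial (Fin 2) ℝ) := by
  have h := prime_X_zero_sq_add_rename_succ (n := 1) (X 0 ^ 2 + 1) 1 (by norm_num)
  rwa [map_add, map_pow, rename_X, map_one, ← add_assoc] at h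

theorem MvPolynomial.prime_sq_add_sq_add_sq :
    Prime (X 0 ^ 2 + X 1 ^ 2 + X 2 ^ 2 : MvPolynomial (Fin 3) ℝ) := by
  have h := prime_X_zero_sq_add_rename_succ (n := 2) (X 0 ^ 2 + X 1 ^ 2) 1 (by norm_num)
  rwa [map_add, map_pow, map_pow, rename_X, rename_X, ← add_assoc] at h

/-! ### Coordinate rings of hypersurfaces -/

/-- The coordinate ring of the hypersurface `q = 0`. -/
def MvPolynomial.Hypersurface {σ R : Type*} [CommRing R] (q : MvPolynomial σ R) : Type _ :=
  MvPolynomial σ R ⧸ Ideal.span {q}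

namespace MvPolynomial.Hypersurface

variable {σ R S : Type*} [CommRing R] (q : MvPolynomial σ R)

noncomputable instance : CommRing (Hypersurface q) := Ideal.Quotient.commRing _

noncomputable instance : Algebra R (Hypersurface q) := Ideal.Quotient.algebra _

/-- The quotient map onto the coordinate ring. -/
noncomputable def mk : MvPolynomial σ R →ₐ[R] Hypersurface q := Ideal.Quotient.mkₐ R _

/-- The coordinate functions. -/
noncomputable def coord (i : σ) : Hypersurface q := mk q (X i)

theorem mk_surjective : Function.Surjective (mk q) := Ideal.Quotient.mkₐ_surjective R _

theorem aeval_coord (f : MvPolynomial σ R) : aeval (coord q) f = mk q f :=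
  DFunLike.congr_fun (f := aeval (coord q)) (g := mk q)
    (algHom_ext fun i => aeval_X (coord q) i) f

theorem aeval_coord_self : aeval (coord q) q = 0 := by
  rw [aeval_coord]
  exact Ideal.Quotient.eq_zero_iff_mem.2 (Ideal.mem_span_singleton_self q)

instance [IsNoetherianRing R] [Finite σ] : IsNoetherianRing (Hypersurface q) :=
  isNoetherianRing_of_surjective _ _ (mk q).toRingHom (mk_surjective q)

instance [Finite σ] : Algebra.FiniteType R (Hypersurface q) :=
  Algebra.FiniteType.of_surjective (mk q) (mk_surjective q)

theorem isDomain_of_prime {q : MvPolynomial σ R} (hq : Prime q) : IsDomain (Hypersurface q) :=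
  (Ideal.Quotient.isDomain_iff_prime _).2 ((Ideal.span_singleton_prime hq.ne_zero).2 hq)

theorem adjoin_range_coord : Algebra.adjoin R (Set.range (coord q)) = ⊤ := by
  have h := AlgHom.map_adjoin (mk q) (Set.range X)
  rw [adjoin_range_X, Algebra.map_top, (AlgHom.range_eq_top _).2 (mk_surjective q),
    ← Set.range_comp] at h
  exact h.symm

variable {q}

theorem algHom_ext [CommRing S] [Algebra R S] {f g : Hypersurface q →ₐ[R] S}
    (h : ∀ i, f (coord q i) = g (coord q i)) : f = g := by
  refine (AlgHom.cancel_right (mk_surjective q)).1 ?_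
  exact MvPolynomial.algHom_ext h

/-- The algebra map out of a coordinate ring given by a point of the hypersurface. -/
noncomputable def lift [CommRing S] [Algebra R S] (v : σ → S) (h : aeval v q = 0) :
    Hypersurface q →ₐ[R] S :=
  Ideal.Quotient.liftₐ _ (aeval v) fun a ha => by
    obtain ⟨b, rfl⟩ := Ideal.mem_span_singleton.1 ha
    rw [map_mul, h, zero_mul]

theorem lift_coord [CommRing S] [Algebra R S] (v : σ → S) (h : aeval v q = 0) (i : σ) :
    lift v h (coord q i) = v i :=
  aeval_X v i

end MvPolynomial.Hypersurface

/-! ### The two rings, and the maximal ideals of the conic -/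

open Hypersurface

/-- The real coordinate ring of the conic `x ^ 2 + y ^ 2 + 1 = 0`. -/
abbrev PointlessConic : Type :=
  Hypersurface (X 0 ^ 2 + X 1 ^ 2 + 1 : MvPolynomial (Fin 2) ℝ)

/-- The real coordinate ring of the cone `x ^ 2 + y ^ 2 + z ^ 2 = 0`. -/
abbrev PointlessCone : Type :=
  Hypersurface (X 0 ^ 2 + X 1 ^ 2 + X 2 ^ 2 : MvPolynomial (Fin 3) ℝ)

instance PointlessConic.isDomain : IsDomain PointlessConic :=
  isDomain_of_prime prime_sq_add_sq_add_one

instance PointlessCone.isDomain : IsDomain PointlessCone :=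
  isDomain_of_prime prime_sq_add_sq_add_sq

/-- The coordinate functions on the conic. -/
noncomputable abbrev PointlessConic.coord (i : Fin 2) : PointlessConic := Hypersurface.coord _ i

/-- The coordinate functions on the cone. -/
noncomputable abbrev PointlessCone.coord (i : Fin 3) : PointlessCone := Hypersurface.coord _ i

/-- The ideal of a nonreal point of `x ^ 2 + y ^ 2 + 1 = 0` is generated by the equation of the
real line through this point and its conjugate. -/
theorem ker_eq_span_of_im_ne_zero {A : Type*} [CommRing A] [Algebra ℝ A] {x y : A}
    (hxy : x ^ 2 + y ^ 2 + 1 = 0) (hA : Algebra.adjoin ℝ {x, y} = ⊤) (φ : A →ₐ[ℝ] ℂ)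
    (hy : (φ y).im ≠ 0) : ∃ l : A, RingHom.ker φ = Ideal.span {l} := by
  set p := (φ x).re with hp
  set q := (φ x).im with hq
  set r := (φ y).re with hr
  set s := (φ y).im with hs
  -- The real `a` and `c` are those with `φ x = a * φ y + c`.
  set a : ℝ := q / s with ha
  set c : ℝ := p - a * r with hc
  set l : A := x - a • y - algebraMap ℝ A c with hl
  have hφl : φ l = 0 := by
    have hre : ∀ t : ℝ, algebraMap ℝ ℂ t = (t : ℂ) := fun t => rfl
    rw [hl, map_sub, map_sub, map_smul, AlgHom.commutes, hre]
    apply Complex.ext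
    · simp [← hp, ← hr, hc]
    · simp [← hq, ← hs, ha, hy]
  have hd : (1 + a ^ 2 : ℝ) ≠ 0 := by positivity
  have hx : l ∣ x - a • y - algebraMap ℝ A c := dvd_rfl
  have hyy : ∃ α β : ℝ, l ∣ y ^ 2 - algebraMap ℝ A α - β • y := by
    -- Substituting `x = a y + c` gives `(1 + a²) y² + 2 a c y + 1 + c² = 0`.
    refine ⟨-(1 + c ^ 2) / (1 + a ^ 2), -(2 * a * c) / (1 + a ^ 2), ?_⟩
    have h1 : l ∣ (x ^ 2 + y ^ 2 + 1) - (x - (a • y + algebraMap ℝ A c)) *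
        (x + (a • y + algebraMap ℝ A c)) := by
      rw [hxy, zero_sub, dvd_neg]
      exact (Dvd.intro _ (by rw [hl, sub_sub]))
    have h2 := h1.mul_left (algebraMap ℝ A (1 + a ^ 2)⁻¹)
    have e : algebraMap ℝ A (1 + a ^ 2)⁻¹ * (1 + algebraMap ℝ A a ^ 2) = 1 := by
      rw [← map_one (algebraMap ℝ A), ← map_pow, ← map_add, ← map_mul, inv_mul_cancel₀ hd, map_one]
    convert h2 using 1
    simp only [div_eq_mul_inv, Algebra.smul_def, map_mul, map_neg, map_add, map_one, map_pow,
      map_ofNat]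
    linear_combination (-y ^ 2) * e
  obtain ⟨α₀, β₀, hyy⟩ := hyy
  -- So `1` and `y` span `A` modulo `l`; their images under `φ` are independent over `ℝ`, hence `l`
  -- generates the kernel.
  have normal : ∀ f : A, ∃ α β : ℝ, l ∣ f - algebraMap ℝ A α - β • y := by
    intro f
    have hf : f ∈ Algebra.adjoin ℝ {x, y} := hA ▸ Algebra.mem_top
    induction hf using Algebra.adjoin_induction with
    | mem f hf =>
      rcases hf with rfl | rfl
      · exact ⟨c, a, by convert hx using 1; ring⟩
      · exact ⟨0, 1, by simp⟩
    | algebraMap t => exact ⟨t, 0, by simp⟩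
    | add f g _ _ hf hg =>
      obtain ⟨α, β, h⟩ := hf
      obtain ⟨γ, δ, h'⟩ := hg
      refine ⟨α + γ, β + δ, ?_⟩
      convert dvd_add h h' using 1
      simp only [map_add, Algebra.smul_def]; ring
    | mul f g _ _ hf hg =>
      obtain ⟨α, β, h⟩ := hf
      obtain ⟨γ, δ, h'⟩ := hg
      refine ⟨α * γ + β * δ * α₀, α * δ + β * γ + β * δ * β₀, ?_⟩
      convert dvd_add (dvd_add (h.mul_left g) (h'.mul_left (algebraMap ℝ A α + β • y)))
        (hyy.mul_left (algebraMap ℝ A (β * δ))) using 1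
      simp only [map_add, map_mul, Algebra.smul_def]; ring
  refine ⟨l, le_antisymm (fun f hf => ?_) ?_⟩
  · rw [RingHom.mem_ker] at hf
    rw [Ideal.mem_span_singleton]
    obtain ⟨α, β, h⟩ := normal f
    have h0 : φ (f - algebraMap ℝ A α - β • y) = 0 := by
      obtain ⟨g, hg⟩ := h
      rw [hg, map_mul, hφl, zero_mul]
    have hre : algebraMap ℝ ℂ α = (α : ℂ) := rfl
    rw [map_sub, map_sub, map_smul, AlgHom.commutes, hre, hf] at h0
    have him := congrArg Complex.im h0
    have hre := congrArg Complex.re h0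
    simp [← hs, hy] at him
    simp [him] at hre
    simpa [him, hre] using h
  · rw [Ideal.span_singleton_le_iff_mem]
    exact hφl

theorem PointlessConic.adjoin_eq_top : Algebra.adjoin ℝ {coord 0, coord 1} = ⊤ := by
  rw [← adjoin_range_coord]
  congr 1
  ext f
  simp [Fin.exists_fin_two, eq_comm]

theorem PointlessConic.aeval_eq {S : Type*} [CommRing S] [Algebra ℝ S] (v : Fin 2 → S) :
    aeval v (X 0 ^ 2 + X 1 ^ 2 + 1 : MvPolynomial (Fin 2) ℝ) = v 0 ^ 2 + v 1 ^ 2 + 1 := by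
  simp

theorem PointlessCone.aeval_eq {S : Type*} [CommRing S] [Algebra ℝ S] (v : Fin 3 → S) :
    aeval v (X 0 ^ 2 + X 1 ^ 2 + X 2 ^ 2 : MvPolynomial (Fin 3) ℝ) =
      v 0 ^ 2 + v 1 ^ 2 + v 2 ^ 2 := by
  simp

theorem PointlessConic.relation : coord 0 ^ 2 + coord 1 ^ 2 + 1 = 0 :=
  (aeval_eq _).symm.trans (aeval_coord_self _)

theorem PointlessCone.relation : coord 0 ^ 2 + coord 1 ^ 2 + coord 2 ^ 2 = 0 :=
  (aeval_eq _).symm.trans (aeval_coord_self _)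

theorem PointlessConic.ker_eq_span (φ : PointlessConic →ₐ[ℝ] ℂ) :
    ∃ l : PointlessConic, RingHom.ker φ = Ideal.span {l} := by
  -- The coordinates cannot both be real, so swapping them if necessary makes the second one
  -- nonreal.
  by_cases hy : (φ (coord 1)).im = 0
  · refine ker_eq_span_of_im_ne_zero (x := coord 1) (y := coord 0)
      (by rw [add_comm (coord 1 ^ 2)]; exact relation)
      (by rw [Set.pair_comm]; exact adjoin_eq_top) φ fun hx => ?_
    have h := congrArg Complex.re (congrArg φ relation)
    rw [map_add, map_add, map_pow, map_pow, map_one, map_zero] at h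
    simp only [sq, Complex.add_re, Complex.mul_re, hx, hy, Complex.one_re, Complex.zero_re,
      mul_zero, sub_zero] at h
    nlinarith [mul_self_nonneg (φ (coord 0)).re, mul_self_nonneg (φ (coord 1)).re]
  · exact ker_eq_span_of_im_ne_zero relation adjoin_eq_top φ hy

/-- A maximal ideal of a finitely generated real algebra is the kernel of a complex point. -/
theorem exists_algHom_complex_ker_eq {A : Type*} [CommRing A] [Algebra ℝ A]
    [Algebra.FiniteType ℝ A] (m : Ideal A) [m.IsMaximal] :
    ∃ φ : A →ₐ[ℝ] ℂ, RingHom.ker φ = m := by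
  let := Ideal.Quotient.field m
  -- Zariski's lemma.
  have : Module.Finite ℝ (A ⧸ m) := finite_of_finite_type_of_isJacobsonRing ℝ (A ⧸ m)
  let f : (A ⧸ m) →ₐ[ℝ] ℂ := IsAlgClosed.lift
  refine ⟨f.comp (Ideal.Quotient.mkₐ ℝ m), ?_⟩
  ext a
  rw [RingHom.mem_ker, AlgHom.comp_apply, map_eq_zero_iff f f.toRingHom.injective,
    Ideal.Quotient.mkₐ_eq_mk, Ideal.Quotient.eq_zero_iff_mem]

/-- An irreducible lies in some maximal ideal, so it is associated to the prime generator of that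
ideal. -/
theorem UniqueFactorizationMonoid.of_isMaximal_eq_span {A : Type*} [CommRing A] [IsDomain A]
    [IsNoetherianRing A] (h : ∀ m : Ideal A, m.IsMaximal → ∃ l, m = Ideal.span {l}) :
    UniqueFactorizationMonoid A := by
  refine { irreducible_iff_prime := fun {a} => ⟨fun ha => ?_, Prime.irreducible⟩ }
  obtain ⟨m, hm, ham⟩ := exists_max_ideal_of_mem_nonunits ha.not_isUnit
  obtain ⟨l, rfl⟩ := h m hm
  rw [Ideal.mem_span_singleton] at ham
  have hl0 : l ≠ 0 := by
    rintro rfl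
    exact ha.ne_zero (zero_dvd_iff.1 ham)
  have hl : Prime l := (Ideal.span_singleton_prime hl0).1 hm.isPrime
  exact ((hl.irreducible.associated_of_dvd ha ham).prime_iff).1 hl

instance PointlessConic.uniqueFactorizationMonoid : UniqueFactorizationMonoid PointlessConic := by
  refine UniqueFactorizationMonoid.of_isMaximal_eq_span fun m hm => ?_
  obtain ⟨φ, rfl⟩ := exists_algHom_complex_ker_eq m
  exact ker_eq_span φ

/-! ### From the conic to the cone -/

/-- The substitution `x ↦ x T`, `y ↦ y T`, `z ↦ T`. -/
noncomputable def PointlessCone.toPolynomial : PointlessCone →ₐ[ℝ] Polynomial PointlessConic :=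
  lift ![Polynomial.C (PointlessConic.coord 0) * Polynomial.X,
      Polynomial.C (PointlessConic.coord 1) * Polynomial.X, Polynomial.X] (by
    have h := congrArg Polynomial.C PointlessConic.relation
    simp only [map_add, map_pow, map_one, map_zero] at h
    simp only [map_add, map_pow, aeval_X, Matrix.cons_val_zero, Matrix.cons_val_one,
      Matrix.cons_val]
    linear_combination Polynomial.X ^ 2 * h)

theorem PointlessCone.toPolynomial_coord_zero :
    toPolynomial (coord 0) = Polynomial.C (PointlessConic.coord 0) * Polynomial.X :=
  lift_coord ..

theorem PointlessCone.toPolynomial_coord_one :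
    toPolynomial (coord 1) = Polynomial.C (PointlessConic.coord 1) * Polynomial.X :=
  lift_coord ..

theorem PointlessCone.toPolynomial_coord_two : toPolynomial (coord 2) = Polynomial.X :=
  lift_coord ..

theorem PointlessCone.coord_two_ne_zero : coord 2 ≠ 0 := fun h =>
  Polynomial.X_ne_zero (by rw [← toPolynomial_coord_two, h, map_zero])

/-- Setting `z = 0` leaves `ℝ[x,y]/(x² + y²)`, a domain; the map `t` shows that `e` kills only
multiples of `z`. -/
theorem PointlessCone.prime_coord_two : Prime (coord 2) := by
  let q : MvPolynomial (Fin 2) ℝ := X 0 ^ 2 + X 1 ^ 2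
  let D := Hypersurface q
  have : IsDomain D := isDomain_of_prime prime_sq_add_sq
  let d : Fin 2 → D := Hypersurface.coord q
  have hd : d 0 ^ 2 + d 1 ^ 2 = 0 := by
    simpa only [q, map_add, map_pow, aeval_X] using aeval_coord_self q
  let e : PointlessCone →ₐ[ℝ] D := lift ![d 0, d 1, 0] (by simpa using hd)
  have he0 : e (coord 0) = d 0 := lift_coord ..
  have he1 : e (coord 1) = d 1 := lift_coord ..
  have he2 : e (coord 2) = 0 := lift_coord ..
  let J : Ideal PointlessCone := Ideal.span {coord 2}
  let m := Ideal.Quotient.mkₐ ℝ J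
  have hm2 : m (coord 2) = 0 :=
    Ideal.Quotient.eq_zero_iff_mem.2 (Ideal.mem_span_singleton_self _)
  let t : D →ₐ[ℝ] PointlessCone ⧸ J := lift ![m (coord 0), m (coord 1)] (by
    have h := congrArg m relation
    rw [map_add, map_add, map_pow, map_pow, map_pow, hm2, map_zero] at h
    simpa [q, zero_pow two_ne_zero] using h)
  have ht0 : t (d 0) = m (coord 0) := lift_coord ..
  have ht1 : t (d 1) = m (coord 1) := lift_coord ..
  have hte : t.comp e = m := by
    refine Hypersurface.algHom_ext fun i => ?_
    change t (e (coord i)) = m (coord i)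
    fin_cases i
    · exact (congrArg t he0).trans ht0
    · exact (congrArg t he1).trans ht1
    · exact (congrArg t he2).trans ((map_zero t).trans hm2.symm)
  have hker : ∀ b, e b = 0 → coord 2 ∣ b := by
    intro b hb
    have h : m b = 0 := by rw [← hte, AlgHom.comp_apply, hb, map_zero]
    exact Ideal.mem_span_singleton.1 (Ideal.Quotient.eq_zero_iff_mem.1 h)
  refine ⟨coord_two_ne_zero, fun hu => ?_, fun f g hfg => ?_⟩
  · exact not_isUnit_zero (he2 ▸ hu.map e)
  · have h : e f * e g = 0 := by
      rw [← map_mul, ← zero_dvd_iff, ← he2]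
      exact map_dvd e hfg
    exact (mul_eq_zero.1 h).imp (hker f) (hker g)

/-- Sending `x`, `y`, `T` to `x/z`, `y/z`, `z` in the fraction field of the cone undoes the
substitution. -/
theorem PointlessCone.toPolynomial_injective : Function.Injective toPolynomial := by
  let K := FractionRing PointlessCone
  let ι : PointlessCone →ₐ[ℝ] K := IsScalarTower.toAlgHom ℝ PointlessCone K
  have hι : Function.Injective ι := IsFractionRing.injective PointlessCone K
  have hz : ι (coord 2) ≠ 0 := (map_ne_zero_iff ι hι).2 coord_two_ne_zero
  let τ : PointlessConic →ₐ[ℝ] K :=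
    lift ![ι (coord 0) / ι (coord 2), ι (coord 1) / ι (coord 2)] (by
      have h := congrArg ι relation
      simp only [map_add, map_pow, map_zero] at h
      rw [PointlessConic.aeval_eq]
      simp only [Matrix.cons_val_zero, Matrix.cons_val_one]
      rw [div_pow, div_pow, ← add_div, div_add_one (pow_ne_zero 2 hz), h, zero_div])
  have hτ0 : τ (PointlessConic.coord 0) = ι (coord 0) / ι (coord 2) := lift_coord ..
  have hτ1 : τ (PointlessConic.coord 1) = ι (coord 1) / ι (coord 2) := lift_coord ..
  let θ : Polynomial PointlessConic →ₐ[ℝ] K :=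
    { Polynomial.eval₂RingHom τ.toRingHom (ι (coord 2)) with
      commutes' := fun r => (Polynomial.eval₂_C ..).trans (τ.commutes r) }
  have hθC : ∀ a, θ (Polynomial.C a) = τ a := fun a => Polynomial.eval₂_C ..
  have hθX : θ Polynomial.X = ι (coord 2) := Polynomial.eval₂_X ..
  have h : θ.comp toPolynomial = ι := by
    refine Hypersurface.algHom_ext fun i => ?_
    change θ (toPolynomial (coord i)) = ι (coord i)
    fin_cases i
    · change θ (toPolynomial (coord 0)) = ι (coord 0)
      rw [toPolynomial_coord_zero, map_mul, hθC, hθX, hτ0, div_mul_cancel₀ _ hz]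
    · change θ (toPolynomial (coord 1)) = ι (coord 1)
      rw [toPolynomial_coord_one, map_mul, hθC, hθX, hτ1, div_mul_cancel₀ _ hz]
    · change θ (toPolynomial (coord 2)) = ι (coord 2)
      rw [toPolynomial_coord_two, hθX]
  refine Function.Injective.of_comp (f := θ) ?_
  rw [← AlgHom.coe_comp, h]
  exact hι

theorem PointlessCone.exists_toPolynomial_eq (u : Polynomial PointlessConic) :
    ∃ (n : ℕ) (b : PointlessCone), toPolynomial b = Polynomial.X ^ n * u := by
  -- `P` is closed under sums and products, so only constants, `x`, `y` and powers of `T` need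
  -- checking.
  let P (u : Polynomial PointlessConic) : Prop :=
    ∃ (n : ℕ) (b : PointlessCone), toPolynomial b = Polynomial.X ^ n * u
  have hadd : ∀ u v, P u → P v → P (u + v) := by
    rintro u v ⟨n, b, hb⟩ ⟨k, c, hc⟩
    refine ⟨n + k, coord 2 ^ k * b + coord 2 ^ n * c, ?_⟩
    rw [map_add, map_mul, map_mul, map_pow, map_pow, toPolynomial_coord_two, hb, hc]
    ring
  have hmul : ∀ u v, P u → P v → P (u * v) := by
    rintro u v ⟨n, b, hb⟩ ⟨k, c, hc⟩
    refine ⟨n + k, b * c, ?_⟩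
    rw [map_mul, hb, hc]
    ring
  have hC : ∀ a, P (Polynomial.C a) := by
    intro a
    have ha : a ∈ Algebra.adjoin ℝ {PointlessConic.coord 0, PointlessConic.coord 1} :=
      PointlessConic.adjoin_eq_top ▸ Algebra.mem_top
    induction ha using Algebra.adjoin_induction with
    | mem a ha =>
      rcases ha with rfl | rfl
      · exact ⟨1, coord 0, by rw [toPolynomial_coord_zero, pow_one, mul_comm]⟩
      · exact ⟨1, coord 1, by rw [toPolynomial_coord_one, pow_one, mul_comm]⟩
    | algebraMap r =>
      exact ⟨0, algebraMap ℝ _ r, by rw [AlgHom.commutes, pow_zero, one_mul]; rfl⟩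
    | add a b _ _ ha hb => rw [map_add]; exact hadd _ _ ha hb
    | mul a b _ _ ha hb => rw [map_mul]; exact hmul _ _ ha hb
  induction u using Polynomial.induction_on' with
  | add u v hu hv => exact hadd u v hu hv
  | monomial n a =>
    rw [← Polynomial.C_mul_X_pow_eq_monomial]
    exact hmul _ _ (hC a)
      ⟨0, coord 2 ^ n, by rw [map_pow, toPolynomial_coord_two, pow_zero, one_mul]⟩

instance PointlessCone.uniqueFactorizationMonoid : UniqueFactorizationMonoid PointlessCone := by
  have hX : toPolynomial.toRingHom (coord 2) = Polynomial.X := toPolynomial_coord_two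
  refine UniqueFactorizationMonoid.of_prime_of_injective toPolynomial.toRingHom
    toPolynomial_injective prime_coord_two ?_ fun u => ?_
  · exact hX ▸ Polynomial.prime_X
  · exact hX ▸ exists_toPolynomial_eq u

theorem mainTheorem6 :
    (IsDomain (MvPolynomial (Fin 2) ℝ ⧸
        Ideal.span {(X 0 ^ 2 + X 1 ^ 2 + 1 : MvPolynomial (Fin 2) ℝ)}) ∧
      UniqueFactorizationMonoid (MvPolynomial (Fin 2) ℝ ⧸
        Ideal.span {(X 0 ^ 2 + X 1 ^ 2 + 1 : MvPolynomial (Fin 2) ℝ)})) ∧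
    (IsDomain (MvPolynomial (Fin 3) ℝ ⧸
        Ideal.span {(X 0 ^ 2 + X 1 ^ 2 + X 2 ^ 2 : MvPolynomial (Fin 3) ℝ)}) ∧
      UniqueFactorizationMonoid (MvPolynomial (Fin 3) ℝ ⧸
        Ideal.span {(X 0 ^ 2 + X 1 ^ 2 + X 2 ^ 2 : MvPolynomial (Fin 3) ℝ)})) :=
  ⟨⟨PointlessConic.isDomain, PointlessConic.uniqueFactorizationMonoid⟩,
    PointlessCone.isDomain, PointlessCone.uniqueFactorizationMonoid⟩
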